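/- Let $G$ be a finite group, let $H$ be a subgroup of $G$, and let $\mathcal{J} = \{J_1, \dots, J_\ell\}$ be a set of nontrivial subgroups of $G$. For a subgroup $U \le G$ put $N_U = \sum_{u \in U} u$. Suppose that $G$ admits a generalised norm relation over $\mathbb{Q}$ with respect to $H$ and $\mathcal{J}$, that is, an equality in $\mathbb{Q}[G]$ of the form $$N_H = \sum_{k=1}^{m} a_k N_{U_k} b_k, \qquad a_k, b_k \in \mathbb{Q}[G],\ U_k \in \mathcal{J}$$ (the $U_k$ need not be distinct). Let the optimal coefficient $c(\mathcal{J},H)$ be the smallest positive integer $c$ for which there exist $n_1, \dots, n_\ell \in \mathbb{N}$, an injective morphism of $\mathbb{Z}[G]$-modules $\psi \colon \mathbb{Z}[G/H] \to \bigoplus_{i=1}^{\ell} \mathbb{Z}[G/J_i]^{n_i}$, and a morphism of $\mathbb{Z}[G]$-modules $\phi \colon \bigoplus_{i=1}^{\ell} \mathbb{Z}[G/J_i]^{n_i} \to \mathbb{Z}[G/H]$ whose image has finite index in $\mathbb{Z}[G/H]$, such that $\phi \circ \psi = c \cdot \mathrm{id}$. Then such a $c$ exists, and $c(\mathcal{J},H)$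 divides $|G|^2$. -/

import Mathlib

/-- The norm element `N_H = ∑_{h ∈ H} h` in the group algebra `R[G]` of a finite group `G`. -/
noncomputable def normElement (R : Type*) [CommRing R] {G : Type*} [Group G] [Finite G]
    (H : Subgroup G) : MonoidAlgebra R G :=
  ∑ᶠ h : H, MonoidAlgebra.of R G (h : G)

/-- `G` admits a generalised norm relation over `R` with respect to `H` and `𝒥`: an equality
`N_H = ∑_{k=1}^{l} a_k N_{J_k} b_k` in `R[G]` with `a_k, b_k ∈ R[G]`, `J_k ∈ 𝒥` and `J_k ≠ 1`
(the same member of `𝒥` may occur several times). -/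
def HasGeneralisedNormRelation (R : Type*) [CommRing R] {G : Type*} [Group G] [Finite G]
    (𝒥 : Set (Subgroup G)) (H : Subgroup G) : Prop :=
  ∃ (l : ℕ) (J : Fin l → Subgroup G) (a b : Fin l → MonoidAlgebra R G),
    (∀ k, J k ∈ 𝒥 ∧ J k ≠ ⊥) ∧
      normElement R H = ∑ k, a k * normElement R (J k) * b k

/-- The permutation module `ℤ[G/H]` as a module over the group ring `ℤ[G]`. -/
abbrev PermModule {G : Type*} [Group G] (H : Subgroup G) : Type _ :=
  (Representation.ofMulAction ℤ G (G ⧸ H)).asModule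

/-- The `ℤ[G]`-module `⨁_{J ∈ 𝒥} ℤ[G/J]^{n_J}`. -/
abbrev PermModuleSum {G : Type*} [Group G] (𝒥 : Set (Subgroup G)) (n : 𝒥 → ℕ) : Type _ :=
  DirectSum 𝒥 fun J => Fin (n J) → PermModule (J : Subgroup G)

/-- The positive integer `c` is realised by `ℤ[G]`-linear maps
`ψ : ℤ[G/H] → ⨁_J ℤ[G/J]^{n_J}`, injective, and `φ : ⨁_J ℤ[G/J]^{n_J} → ℤ[G/H]`, with image of
finite index, such that `φ ∘ ψ = c · id`, for some `n_J ∈ ℕ`. -/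
def IsNormCoefficient {G : Type*} [Group G] (𝒥 : Set (Subgroup G)) (H : Subgroup G)
    (c : ℕ) : Prop :=
  0 < c ∧ ∃ (n : 𝒥 → ℕ)
    (ψ : PermModule H →ₗ[MonoidAlgebra ℤ G] PermModuleSum 𝒥 n)
    (φ : PermModuleSum 𝒥 n →ₗ[MonoidAlgebra ℤ G] PermModule H),
    Function.Injective ψ ∧
      (LinearMap.range φ).toAddSubgroup.FiniteIndex ∧
      φ ∘ₗ ψ = c • LinearMap.id

/-- The optimal coefficient `c(𝒥, H)`: the smallest positive integer `c` realised as above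
(`0` if there is none, which never divides a positive integer). -/
noncomputable def optimalCoefficient {G : Type*} [Group G] (𝒥 : Set (Subgroup G))
    (H : Subgroup G) : ℕ :=
  sInf {c : ℕ | IsNormCoefficient 𝒥 H c}

/-! The integers `c` for which `c · id` on `ℤ[G/H]` is a sum of maps factoring through the modules
`ℤ[G/J]` form an ideal of `ℤ`. For `c > 0` this condition is all that a norm coefficient requires,
since injectivity and finite index follow from `φ ∘ ψ = c · id`. So the least norm coefficient
divides every other one, and it suffices to show that `|G|²` is one.

Let `Λ` be the endomorphism ring of `ℤ[G/H] ⊕ ⨁ₖ ℤ[G/Jₖ]`, realised as `G`-invariant integral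
matrices, and let `ε` be the projection onto the second summand. The `H`-corner of `ΛεΛ` consists of
the sums of maps factoring through the `ℤ[G/Jₖ]`. Clearing denominators in the norm relation puts
some positive integer in `ΛεΛ`, and the task is to show that `|G|²` lies there.

A trace computation gives `|G| O ⊆ Λ` for every order `O ⊇ Λ`
(`Matrix.card_mul_mem_integralInvariant`). Let `M` be a maximal such order. The ideal `MεM` is
idempotent and contains a positive integer, and in a maximal order such an ideal is the whole ring
(`Subring.eq_top_of_isIdempotent_of_forall_multiplier`). Hence `1 = ∑ xεy` with `x, y ∈ M`, and
`|G|² = ∑ (|G|x) ε (|G|y)` lies in `ΛεΛ` (`Subring.sq_mem_closure_of_isIdempotentElem`). -/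

/-! ### Idempotent two-sided ideals in Artinian rings and maximal orders -/

/-- In an Artinian ring every two-sided ideal has a two-sided complement modulo nilpotents. -/
theorem Ideal.exists_isTwoSided_sup_eq_top_of_isArtinianRing {R : Type*} [Ring R]
    [IsArtinianRing R] (T : Ideal R) [T.IsTwoSided] :
    ∃ Q : Ideal R, Q.IsTwoSided ∧ T ⊔ Q = ⊤ ∧ ∃ n : ℕ, (T * Q) ^ n = ⊥ := by
  let J := Ring.jacobson R
  -- `Q` is the right annihilator of `T` modulo the Jacobson radical.
  let Q : Ideal R :=
    { carrier := {x | ∀ t ∈ T, t * x ∈ J}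
      add_mem' := fun {x y} hx hy t ht => by rw [mul_add]; exact J.add_mem (hx t ht) (hy t ht)
      zero_mem' := fun t _ => by rw [mul_zero]; exact J.zero_mem
      smul_mem' := fun r x hx t ht => by
        rw [smul_eq_mul, ← mul_assoc]; exact hx _ (Ideal.mul_mem_right r T ht) }
  refine ⟨Q, ⟨fun r hx t ht => ?_⟩, ?_, ?_⟩
  · rw [← mul_assoc]; exact Ideal.mul_mem_right r J (hx t ht)
  -- `R ⧸ J` is semisimple, so the image of `T` has a left-ideal complement `L`. As `T` is
  -- two-sided, `T L ⊆ T ∩ L = 0`, so `L` lifts into `Q`.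
  · obtain ⟨L, hL⟩ := exists_isCompl (T.map (Ideal.Quotient.mk J))
    have hs : Function.Surjective (Ideal.Quotient.mk J) := Ideal.Quotient.mk_surjective
    have h1 : (1 : R ⧸ J) ∈ T.map (Ideal.Quotient.mk J) ⊔ L := by
      rw [hL.sup_eq_top]; trivial
    obtain ⟨t', ht', l', hl', h⟩ := Submodule.mem_sup.1 h1
    obtain ⟨t, ht, rfl⟩ := (Ideal.mem_map_iff_of_surjective _ hs).1 ht'
    obtain ⟨l, rfl⟩ := hs l'
    have hl : l ∈ Q := fun u hu => by
      rw [← Ideal.Quotient.eq_zero_iff_mem, map_mul]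
      have : Ideal.Quotient.mk J u * Ideal.Quotient.mk J l ∈
          T.map (Ideal.Quotient.mk J) ⊓ L := by
        refine ⟨?_, L.mul_mem_left _ hl'⟩
        rw [← map_mul]
        exact Ideal.mem_map_of_mem _ (Ideal.mul_mem_right l T hu)
      rwa [hL.inf_eq_bot, Submodule.mem_bot] at this
    have hj : 1 - (t + l) ∈ J := by
      rw [← Ideal.Quotient.eq_zero_iff_mem, map_sub, map_add, map_one, h, sub_self]
    have hjQ : 1 - (t + l) ∈ Q := fun u _ => J.mul_mem_left u hj
    rw [Ideal.eq_top_iff_one]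
    have : (1 : R) = t + (l + (1 - (t + l))) := by abel
    rw [this]
    exact Submodule.add_mem_sup ht (Q.add_mem hl hjQ)
  · obtain ⟨n, hn⟩ := IsSemiprimaryRing.isNilpotent (R := R)
    refine ⟨n, ?_⟩
    have hTQ : T * Q ≤ J := Ideal.mul_le.2 fun t ht q hq => hq t ht
    exact le_bot_iff.1 ((Ideal.pow_right_mono hTQ n).trans hn.le)

/-- A two-sided ideal `T` of an Artinian ring is everything if `C T D = 0` forces `D C = 0`. -/
theorem Ideal.eq_top_of_forall_mul_eq_bot {R : Type*} [Ring R] [IsArtinianRing R] (T : Ideal R)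
    [T.IsTwoSided] (h : ∀ C D : Ideal R, C.IsTwoSided → D.IsTwoSided → C * T * D = ⊥ →
      D * C = ⊥) : T = ⊤ := by
  obtain ⟨Q, hQ, hsup, n, hn⟩ := T.exists_isTwoSided_sup_eq_top_of_isArtinianRing
  -- Taking `C = Q` and `D = Q (TQ)^k Q^j` in `h` trades one factor `TQ` for a factor `Q` on the
  -- right. Nilpotence of `TQ` thus becomes nilpotence of `Q`, and `T + Q = R` then forces `T = R`.
  have key : ∀ k j : ℕ, Q * (T * Q) ^ k * Q ^ j = ⊥ → Q ^ (k + j + 1) = ⊥ := by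
    intro k
    induction k with
    | zero =>
      intro j hj
      rwa [Submodule.pow_zero, Ideal.IsTwoSided.mul_one, ← Ideal.IsTwoSided.pow_succ,
        ← zero_add j] at hj
    | succ k ih =>
      intro j hj
      have := h Q (Q * (T * Q) ^ k * Q ^ j) hQ inferInstance (by
        rw [← hj, Ideal.IsTwoSided.pow_succ]; simp only [mul_assoc])
      rw [mul_assoc, ← Submodule.pow_succ] at this
      have := ih (j + 1) this
      rwa [show k + 1 + j + 1 = k + (j + 1) + 1 by omega]
  have hQn : Q ^ (n + 0 + 1) = ⊥ := key n 0 (by rw [hn, Ideal.mul_bot, Ideal.bot_mul])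
  have := Ideal.sup_pow_eq_top (n := n + 0 + 1) hsup
  rwa [hQn, sup_bot_eq] at this

/-- An idempotent full two-sided ideal of a ring `M ⊆ B` is everything, provided `M` is the right
multiplier ring of each of its full two-sided ideals. -/
theorem Subring.eq_top_of_isIdempotent_of_forall_multiplier {B : Type*} [Ring B]
    (M : Subring B) (a b : B) (haM : a ∈ M) (hab : a * b = 1) (hac : ∀ x, a * x = x * a)
    (hfin : ∀ I : Ideal M, I.IsTwoSided → ⟨a, haM⟩ ∈ I → Finite (M ⧸ I))
    (hmax : ∀ C : Ideal M, C.IsTwoSided → ⟨a, haM⟩ ∈ C → ∀ x : B,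
      (∀ c ∈ C, ∃ c' ∈ C, (c : B) * x = (c' : M)) → x ∈ M)
    (T : Ideal M) [T.IsTwoSided] (hT : T ≤ T * T) (haT : ⟨a, haM⟩ ∈ T) : T = ⊤ := by
  set α : M := ⟨a, haM⟩ with hα
  have hαc : ∀ x : M, α * x = x * α := fun x => Subtype.ext (hac x)
  have hbc : ∀ x, b * x = x * b := fun x => by
    have hba : b * a = 1 := by rw [← hac, hab]
    calc b * x = b * x * (a * b) := by rw [hab, mul_one]
      _ = b * (a * x) * b := by rw [hac x]; simp only [mul_assoc]
      _ = x * b := by rw [← mul_assoc b a, hba, one_mul]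
  let I : Ideal M := Ideal.span {α}
  have hI : ∀ x, x ∈ I ↔ ∃ m, x = α * m := fun x => by
    rw [Ideal.mem_span_singleton']
    exact ⟨fun ⟨m, hm⟩ => ⟨m, by rw [← hm, hαc]⟩, fun ⟨m, hm⟩ => ⟨m, by rw [hm, hαc]⟩⟩
  have hI2 : I.IsTwoSided := ⟨fun {x} r hx => by
    obtain ⟨m, rfl⟩ := (hI x).1 hx
    exact (hI _).2 ⟨m * r, by rw [mul_assoc]⟩⟩
  -- Since `T = T²`, the inclusion `T z ⊆ M` improves to `T z ⊆ T`, so `z` is a right multiplier of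
  -- `T`.
  have hTx : ∀ z : B, (∀ t ∈ T, (t : B) * z ∈ M) → z ∈ M := by
    intro z hz
    refine hmax T inferInstance haT z fun t ht => ?_
    have : ∀ t ∈ T * T, ∃ c' ∈ T, (t : B) * z = (c' : M) := by
      intro t ht
      induction ht using Submodule.mul_induction_on' with
      | mem_mul_mem t₁ h₁ t₂ h₂ =>
        refine ⟨t₁ * ⟨_, hz t₂ h₂⟩, Ideal.mul_mem_right _ T h₁, ?_⟩
        simp [mul_assoc]
      | add x _ y _ hx hy =>
        obtain ⟨c, hc, h⟩ := hx
        obtain ⟨d, hd, h'⟩ := hy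
        exact ⟨c + d, T.add_mem hc hd, by simp [add_mul, h, h']⟩
    exact this t (hT ht)
  -- This is the Artinian criterion for `M ⧸ aM`, lifted to `M`. With `z = a⁻¹dc`, one has `c'(tz) =
  -- (a⁻¹c'td)c ∈ C`, so each `tz` multiplies `C` into itself and lies in `M`; hence `z ∈ M`.
  have key : ∀ C D : Ideal M, C.IsTwoSided → D.IsTwoSided → α ∈ C →
      (∀ c ∈ C, ∀ t ∈ T, ∀ d ∈ D, c * t * d ∈ I) → ∀ d ∈ D, ∀ c ∈ C, d * c ∈ I := by
    intro C D hC hD haC h d hd c hc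
    have hz : b * (d * c) ∈ M := by
      refine hTx _ fun t ht => ?_
      refine hmax C hC haC _ fun c' hc' => ?_
      obtain ⟨m, hm⟩ := (hI _).1 (h c' hc' t ht d hd)
      refine ⟨m * c, C.mul_mem_left _ hc, ?_⟩
      have hm' : (c' : B) * t * d = a * m := congrArg Subtype.val hm
      calc (c' : B) * (t * (b * (d * c))) = (c' * t) * b * d * c := by simp only [mul_assoc]
        _ = b * (c' * t * d) * c := by rw [← hbc]; simp only [mul_assoc]
        _ = (b * a) * m * c := by rw [hm']; simp only [mul_assoc]
        _ = _ := by rw [← hac, hab, one_mul]; rfl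
    refine (hI _).2 ⟨⟨_, hz⟩, Subtype.ext ?_⟩
    change (d : B) * c = a * (b * (d * c))
    rw [← mul_assoc a, hab, one_mul]
  have : Finite (M ⧸ I) := hfin I hI2 (Ideal.subset_span rfl)
  let f := Ideal.Quotient.mk I
  have hs : Function.Surjective f := Ideal.Quotient.mk_surjective
  have hIT : I ≤ T := (Ideal.span_singleton_le_iff_mem _).2 haT
  have hT2 : (T.map f).IsTwoSided := ⟨fun {x} r hx => by
    obtain ⟨x, hx', rfl⟩ := (Ideal.mem_map_iff_of_surjective _ hs).1 hx
    obtain ⟨r, rfl⟩ := hs r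
    rw [← map_mul]
    exact Ideal.mem_map_of_mem f (Ideal.mul_mem_right r T hx')⟩
  have htop : T.map f = ⊤ := by
    refine Ideal.eq_top_of_forall_mul_eq_bot _ fun C D hC hD h => ?_
    rw [eq_bot_iff, Ideal.mul_le]
    intro d hd c hc
    obtain ⟨d, rfl⟩ := hs d
    obtain ⟨c, rfl⟩ := hs c
    rw [Submodule.mem_bot, ← map_mul, Ideal.Quotient.eq_zero_iff_mem]
    refine key (C.comap f) (D.comap f) inferInstance inferInstance ?_ ?_ d hd c hc
    · rw [Ideal.mem_comap, show f α = 0 from Ideal.Quotient.eq_zero_iff_mem.2 (Ideal.subset_span rfl)]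
      exact C.zero_mem
    · intro c hc t ht d hd
      rw [← Ideal.Quotient.eq_zero_iff_mem, map_mul, map_mul]
      have := Ideal.mul_mem_mul (Ideal.mul_mem_mul (Ideal.mem_comap.1 hc) (Ideal.mem_map_of_mem f ht))
        (Ideal.mem_comap.1 hd)
      rwa [h] at this
  rw [Ideal.eq_top_iff_one] at htop ⊢
  obtain ⟨t, ht, h1⟩ := (Ideal.mem_map_iff_of_surjective _ hs).1 htop
  have : t - 1 ∈ I := by
    rw [← Ideal.Quotient.eq_zero_iff_mem, map_sub, map_one]
    exact sub_eq_zero.2 h1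
  have := T.sub_mem ht (hIT this)
  rwa [sub_sub_cancel] at this

/-! ### Maximal overorders and the ideal generated by an idempotent -/

/-- Among the subrings `O ⊇ Λ` with `N O ⊆ Λ` there is a maximal one. -/
theorem Subring.exists_maximal_of_fg {B : Type*} [Ring B] [Algebra ℚ B] (Λ : Subring B)
    [Module.Finite ℤ Λ] {N : ℕ} (hN : N ≠ 0) :
    ∃ M : Subring B, Λ ≤ M ∧ (∀ x ∈ M, (N : B) * x ∈ Λ) ∧
      ∀ O : Subring B, M ≤ O → (∀ x ∈ O, (N : B) * x ∈ Λ) → O ≤ M := by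
  -- `F O` is `N O ∩ Λ`. It equals `N O` for the rings considered, so it determines `O`, and the
  -- Noetherian module `Λ` supplies a maximal element.
  let F : Subring B → Submodule ℤ Λ := fun O =>
    { carrier := {y | (N⁻¹ : ℚ) • (y : B) ∈ O}
      add_mem' := fun {x y} hx hy => by
        simpa only [Set.mem_ofPred_eq, Subring.coe_add, smul_add] using O.add_mem hx hy
      zero_mem' := by
        simpa only [Set.mem_ofPred_eq, Subring.coe_zero, smul_zero] using O.zero_mem
      smul_mem' := fun n x hx => by
        have : (N⁻¹ : ℚ) • ((n • x : Λ) : B) = n • ((N⁻¹ : ℚ) • (x : B)) := by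
          rw [smul_comm]; rfl
        simpa only [Set.mem_ofPred_eq, this] using O.zsmul_mem hx n }
  have hNx : ∀ x : B, (N⁻¹ : ℚ) • ((N : B) * x) = x := fun x => by
    rw [← nsmul_eq_mul, ← Nat.cast_smul_eq_nsmul ℚ, smul_smul,
      inv_mul_cancel₀ (Nat.cast_ne_zero.2 hN), one_smul]
  let S : Set (Submodule ℤ Λ) := F '' {O | Λ ≤ O ∧ ∀ x ∈ O, (N : B) * x ∈ Λ}
  have hS : S.Nonempty :=
    ⟨_, Λ, ⟨le_rfl, fun x hx => Λ.mul_mem (natCast_mem Λ N) hx⟩, rfl⟩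
  obtain ⟨_, ⟨M, ⟨hΛM, hM⟩, rfl⟩, hmax⟩ := WellFounded.has_min
    (wellFounded_gt : WellFounded ((· > ·) : Submodule ℤ Λ → Submodule ℤ Λ → Prop)) S hS
  refine ⟨M, hΛM, hM, fun O hMO hO x hx => ?_⟩
  have hle : F M ≤ F O := fun y hy => hMO hy
  have heq : F M = F O := by
    by_contra hne
    exact hmax (F O) ⟨O, ⟨hΛM.trans hMO, hO⟩, rfl⟩ (lt_of_le_of_ne hle hne)
  have : (⟨_, hO x hx⟩ : Λ) ∈ F O := by
    change (N⁻¹ : ℚ) • ((N : B) * x) ∈ O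
    rwa [hNx]
  rw [← heq] at this
  change (N⁻¹ : ℚ) • ((N : B) * x) ∈ M at this
  rwa [hNx] at this

theorem Subring.finite_of_natCast_mul_mem {B : Type*} [Ring B] [Algebra ℚ B] (Λ : Subring B)
    [Module.Finite ℤ Λ] {M : Subring B} {N : ℕ} (hN : N ≠ 0) (hM : ∀ x ∈ M, (N : B) * x ∈ Λ) :
    Module.Finite ℤ M := by
  let f : M →ₗ[ℤ] Λ := AddMonoidHom.toIntLinearMap
    { toFun := fun x => ⟨(N : B) * x, hM x x.2⟩
      map_zero' := Subtype.ext (mul_zero _)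
      map_add' := fun x y => Subtype.ext (mul_add _ _ _) }
  refine Module.Finite.of_injective f fun x y hxy => Subtype.ext ?_
  have h : (N : B) * x = N * y := congrArg Subtype.val hxy
  rw [← nsmul_eq_mul, ← nsmul_eq_mul, ← Nat.cast_smul_eq_nsmul ℚ,
    ← Nat.cast_smul_eq_nsmul ℚ] at h
  simpa [smul_smul, hN] using congrArg ((N⁻¹ : ℚ) • ·) h

/-- Let `Λ` be an order such that `N O ⊆ Λ` for all orders `O ⊇ Λ`. If the two-sided ideal
generated by an idempotent of `Λ` contains a positive integer, then it contains `N ^ 2`. -/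
theorem Subring.sq_mem_closure_of_isIdempotentElem {B : Type*} [Ring B] [Algebra ℚ B]
    (Λ : Subring B) [Module.Finite ℤ Λ] {N : ℕ} (hN : N ≠ 0)
    (hΛ : ∀ O : Subring B, Λ ≤ O → ∀ d : ℕ, d ≠ 0 → (∀ x ∈ O, (d : B) * x ∈ Λ) →
      ∀ x ∈ O, (N : B) * x ∈ Λ)
    {ε : B} (hε : ε ∈ Λ) (hε2 : ε * ε = ε) {a : ℕ} (ha : a ≠ 0)
    (haε : (a : B) ∈ AddSubgroup.closure {z : B | ∃ x ∈ Λ, ∃ y ∈ Λ, z = x * ε * y}) :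
    (N : B) * N ∈ AddSubgroup.closure {z : B | ∃ x ∈ Λ, ∃ y ∈ Λ, z = x * ε * y} := by
  obtain ⟨M, hΛM, hM, hmax⟩ := Λ.exists_maximal_of_fg hN
  let W : AddSubgroup B := AddSubgroup.closure {z : B | ∃ x ∈ M, ∃ y ∈ M, z = x * ε * y}
  have hWl : ∀ m ∈ M, ∀ w ∈ W, m * w ∈ W := fun m hm w hw => by
    induction hw using AddSubgroup.closure_induction with
    | mem w hw =>
      obtain ⟨x, hx, y, hy, rfl⟩ := hw
      exact AddSubgroup.subset_closure ⟨m * x, M.mul_mem hm hx, y, hy, by simp only [mul_assoc]⟩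
    | zero => rw [mul_zero]; exact W.zero_mem
    | add x y _ _ hx hy => rw [mul_add]; exact W.add_mem hx hy
    | neg x _ hx => rw [mul_neg]; exact W.neg_mem hx
  have hWr : ∀ m ∈ M, ∀ w ∈ W, w * m ∈ W := fun m hm w hw => by
    induction hw using AddSubgroup.closure_induction with
    | mem w hw =>
      obtain ⟨x, hx, y, hy, rfl⟩ := hw
      exact AddSubgroup.subset_closure ⟨x, hx, y * m, M.mul_mem hy hm, by simp only [mul_assoc]⟩
    | zero => rw [zero_mul]; exact W.zero_mem
    | add x y _ _ hx hy => rw [add_mul]; exact W.add_mem hx hy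
    | neg x _ hx => rw [neg_mul]; exact W.neg_mem hx
  let T : Ideal M :=
    { carrier := {z | (z : B) ∈ W}
      add_mem' := fun hx hy => W.add_mem hx hy
      zero_mem' := W.zero_mem
      smul_mem' := fun m x hx => hWl m m.2 x hx }
  have hT2 : T.IsTwoSided := ⟨fun m hx => hWr m m.2 _ hx⟩
  have hTT : T ≤ T * T := by
    have : ∀ w ∈ W, ∃ z ∈ T * T, (z : B) = w := fun w hw => by
      induction hw using AddSubgroup.closure_induction with
      | mem w hw =>
        obtain ⟨x, hx, y, hy, rfl⟩ := hw
        have hε' := hΛM hε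
        have h₁ : (⟨x * ε, M.mul_mem hx hε'⟩ : M) ∈ T :=
          AddSubgroup.subset_closure ⟨x, hx, 1, M.one_mem, by rw [mul_one]⟩
        have h₂ : (⟨ε * y, M.mul_mem hε' hy⟩ : M) ∈ T :=
          AddSubgroup.subset_closure ⟨1, M.one_mem, y, hy, by rw [one_mul]⟩
        -- Idempotence of `ε` splits the generator: `xεy = (xε)(εy)`.
        refine ⟨_, Ideal.mul_mem_mul h₁ h₂, ?_⟩
        change x * ε * (ε * y) = _
        rw [← mul_assoc, mul_assoc x, hε2]
      | zero => exact ⟨0, Submodule.zero_mem _, rfl⟩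
      | add x y _ _ hx hy =>
        obtain ⟨u, hu, rfl⟩ := hx
        obtain ⟨v, hv, rfl⟩ := hy
        exact ⟨u + v, Submodule.add_mem _ hu hv, rfl⟩
      | neg x _ hx =>
        obtain ⟨u, hu, rfl⟩ := hx
        exact ⟨-u, Submodule.neg_mem _ hu, rfl⟩
    intro t ht
    obtain ⟨z, hz, h⟩ := this t ht
    rwa [← Subtype.ext h]
  have haM : (a : B) ∈ M := natCast_mem M a
  have haT : (⟨a, haM⟩ : M) ∈ T := by
    refine AddSubgroup.closure_mono ?_ haε
    rintro _ ⟨x, hx, y, hy, rfl⟩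
    exact ⟨x, hΛM hx, y, hΛM hy, rfl⟩
  have hMfin : Module.Finite ℤ M := Λ.finite_of_natCast_mul_mem hN hM
  have htop : T = ⊤ := by
    refine M.eq_top_of_isIdempotent_of_forall_multiplier (a : B)
      (algebraMap ℚ B (a⁻¹ : ℚ)) haM ?_ (fun x => (Nat.cast_commute a x).eq) ?_ ?_ T hTT haT
    · rw [← map_natCast (algebraMap ℚ B), ← map_mul, mul_inv_cancel₀ (Nat.cast_ne_zero.2 ha),
        map_one]
    · intro I hI haI
      have : Module.Finite ℤ (M ⧸ I) :=
        Module.Finite.of_surjective (Ideal.Quotient.mk I).toAddMonoidHom.toIntLinearMap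
          Ideal.Quotient.mk_surjective
      refine Module.finite_of_fg_torsion _ fun x => ?_
      obtain ⟨x, rfl⟩ := Ideal.Quotient.mk_surjective x
      refine ⟨⟨(a : ℤ), mem_nonZeroDivisors_of_ne_zero (Nat.cast_ne_zero.2 ha)⟩, ?_⟩
      change (a : ℤ) • Ideal.Quotient.mk I x = 0
      rw [natCast_zsmul, nsmul_eq_mul, ← map_natCast (Ideal.Quotient.mk I), ← map_mul,
        Ideal.Quotient.eq_zero_iff_mem]
      exact Ideal.mul_mem_right x I haI
    · intro C hC haC x hx
      -- `O` is the right multiplier ring of `C`. From `a ∈ C` follows `a O ⊆ C ⊆ M`, hence `N a O ⊆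
      -- Λ`; the hypothesis on overorders sharpens this to `N O ⊆ Λ`, and maximality gives `O ≤ M`.
      let O : Subring B :=
        { carrier := {x | ∀ c ∈ C, ∃ c' ∈ C, (c : B) * x = (c' : M)}
          mul_mem' := fun {x y} hx hy c hc => by
            obtain ⟨c', hc', h⟩ := hx c hc
            obtain ⟨c'', hc'', h'⟩ := hy c' hc'
            exact ⟨c'', hc'', by rw [← mul_assoc, h, h']⟩
          one_mem' := fun c hc => ⟨c, hc, mul_one _⟩
          add_mem' := fun {x y} hx hy c hc => by
            obtain ⟨c', hc', h⟩ := hx c hc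
            obtain ⟨c'', hc'', h'⟩ := hy c hc
            exact ⟨c' + c'', C.add_mem hc' hc'', by rw [mul_add, h, h']; rfl⟩
          zero_mem' := fun c hc => ⟨0, C.zero_mem, mul_zero _⟩
          neg_mem' := fun {x} hx c hc => by
            obtain ⟨c', hc', h⟩ := hx c hc
            exact ⟨-c', C.neg_mem hc', by rw [mul_neg, h]; rfl⟩ }
      have hMO : M ≤ O := fun m hm c hc => ⟨c * ⟨m, hm⟩, Ideal.mul_mem_right _ C hc, rfl⟩
      refine hmax O hMO (hΛ O (hΛM.trans hMO) (N * a) (mul_ne_zero hN ha) fun y hy => ?_) hx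
      obtain ⟨c', -, h⟩ := hy _ haC
      change (a : B) * y = c' at h
      rw [Nat.cast_mul, mul_assoc, h]
      exact hM _ c'.2
  have h1 : (1 : B) ∈ W := by
    have : (1 : M) ∈ T := by rw [htop]; trivial
    exact this
  have key : ∀ w ∈ W, (N : B) * N * w ∈
      AddSubgroup.closure {z : B | ∃ x ∈ Λ, ∃ y ∈ Λ, z = x * ε * y} := fun w hw => by
    induction hw using AddSubgroup.closure_induction with
    | mem w hw =>
      obtain ⟨x, hx, y, hy, rfl⟩ := hw
      refine AddSubgroup.subset_closure ⟨N * x, hM x hx, N * y, hM y hy, ?_⟩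
      rw [show (N : B) * x * ε * (N * y) = N * (x * ε * N) * y by simp only [mul_assoc],
        ← (Nat.cast_commute N (x * ε)).eq]
      simp only [mul_assoc]
    | zero => rw [mul_zero]; exact AddSubgroup.zero_mem _
    | add x y _ _ hx hy => rw [mul_add]; exact AddSubgroup.add_mem _ hx hy
    | neg x _ hx => rw [mul_neg]; exact AddSubgroup.neg_mem _ hx
  simpa using key 1 h1

/-! ### The order of invariant integral matrices -/

/-- The trace of an integral rational matrix is integral. -/
theorem Matrix.isIntegral_trace {n : Type*} [Fintype n] [DecidableEq n] {x : Matrix n n ℚ}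
    (hx : IsIntegral ℤ x) : IsIntegral ℤ x.trace := by
  let K := AlgebraicClosure ℚ
  let φ : Matrix n n ℚ →ₐ[ℚ] Matrix n n K := (Algebra.ofId ℚ K).mapMatrix
  have hφ : IsIntegral ℤ (φ x) := hx.map (φ.restrictScalars ℤ)
  have htr : algebraMap ℚ K x.trace = (φ x).trace := by
    simp [φ, Matrix.trace]
  rw [← isIntegral_algebraMap_iff (B := K) (algebraMap ℚ K).injective, htr,
    Matrix.trace_eq_sum_roots_charpoly]
  refine IsIntegral.multiset_sum fun r hr => ?_
  have hr := (Matrix.mem_spectrum_iff_isRoot_charpoly).2 (Polynomial.isRoot_of_mem_roots hr)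
  obtain ⟨p, hp, h0⟩ := hφ
  refine ⟨p, hp, ?_⟩
  rcases isEmpty_or_nonempty n with h | h
  · exact absurd hr (by simp [spectrum.of_subsingleton])
  have := spectrum.subset_polynomial_aeval (φ x) (p.map (algebraMap ℤ K)) ⟨r, hr, rfl⟩
  rw [Polynomial.aeval_map_algebraMap, Polynomial.aeval_def, h0, spectrum.zero_eq] at this
  simpa [Polynomial.eval_map] using this

/-- A matrix indexed by `G`-sets is invariant if its entries are constant on `G`-orbits. -/
def Matrix.IsInvariant (G : Type*) {m n R : Type*} [SMul G m] [SMul G n] (x : Matrix m n R) :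
    Prop :=
  ∀ (g : G) (i : m) (j : n), x (g • i) (g • j) = x i j

theorem Matrix.IsInvariant.mul {G l m n R : Type*} [Group G] [MulAction G l] [MulAction G m]
    [MulAction G n] [Fintype m] [NonUnitalNonAssocSemiring R] {x : Matrix l m R}
    {y : Matrix m n R} (hx : x.IsInvariant G) (hy : y.IsInvariant G) :
    (x * y).IsInvariant G := fun g i j => by
  rw [Matrix.mul_apply, Matrix.mul_apply, ← Equiv.sum_comp (MulAction.toPerm g)]
  exact Finset.sum_congr rfl fun k _ => by rw [MulAction.toPerm_apply, hx, hy]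

theorem Matrix.IsInvariant.one {G n R : Type*} [Group G] [MulAction G n] [DecidableEq n]
    [Zero R] [One R] : (1 : Matrix n n R).IsInvariant G := fun g i j => by
  simp [Matrix.one_apply]

theorem Matrix.IsInvariant.transpose {G m n R : Type*} [SMul G m] [SMul G n] {x : Matrix m n R}
    (hx : x.IsInvariant G) : x.transpose.IsInvariant G := fun g i j => hx g j i

/-- The order of integral invariant matrices in the algebra of rational matrices. -/
def Matrix.integralInvariant (G n : Type*) [Group G] [MulAction G n] [Fintype n]
    [DecidableEq n] : Subring (Matrix n n ℚ) where
  carrier := {x | x.IsInvariant G ∧ ∃ y : Matrix n n ℤ, x = y.map (Int.castRingHom ℚ)}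
  mul_mem' := by
    rintro _ _ ⟨hx, x, rfl⟩ ⟨hy, y, rfl⟩
    exact ⟨hx.mul hy, x * y, by rw [Matrix.map_mul]⟩
  one_mem' := ⟨.one, 1, by simp⟩
  add_mem' := by
    rintro _ _ ⟨hx, x, rfl⟩ ⟨hy, y, rfl⟩
    exact ⟨fun g i j => by rw [Matrix.add_apply, Matrix.add_apply, hx, hy], x + y,
      by ext; simp⟩
  zero_mem' := ⟨fun _ _ _ => rfl, 0, by simp⟩
  neg_mem' := by
    rintro _ ⟨hx, x, rfl⟩
    exact ⟨fun g i j => by rw [Matrix.neg_apply, Matrix.neg_apply, hx], -x, by ext; simp⟩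

instance Matrix.finite_integralInvariant (G n : Type*) [Group G] [MulAction G n] [Fintype n]
    [DecidableEq n] : Module.Finite ℤ (Matrix.integralInvariant G n) := by
  let f : Matrix n n ℤ →ₗ[ℤ] Matrix n n ℚ :=
    (AddMonoidHom.mapMatrix (Int.castRingHom ℚ).toAddMonoidHom).toIntLinearMap
  let h : Matrix.integralInvariant G n →ₗ[ℤ] LinearMap.range f := AddMonoidHom.toIntLinearMap
    { toFun := fun x => ⟨x, by obtain ⟨y, hy⟩ := x.2.2; exact ⟨y, hy.symm⟩⟩
      map_zero' := rfl
      map_add' := fun _ _ => rfl }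
  exact Module.Finite.of_injective h fun x y hxy => Subtype.ext (congrArg (Submodule.subtype _) hxy)

/-- Every order containing the order `Λ` of integral invariant matrices lies in `|G|⁻¹ Λ`. -/
theorem Matrix.card_mul_mem_integralInvariant {G n : Type*} [Group G] [Fintype G] [MulAction G n]
    [Fintype n] [DecidableEq n] {O : Subring (Matrix n n ℚ)}
    (hO : Matrix.integralInvariant G n ≤ O) {d : ℕ} (hd : d ≠ 0)
    (hdO : ∀ x ∈ O, (d : Matrix n n ℚ) * x ∈ Matrix.integralInvariant G n)
    {x : Matrix n n ℚ} (hx : x ∈ O) :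
    (Fintype.card G : Matrix n n ℚ) * x ∈ Matrix.integralInvariant G n := by
  have hfin : Module.Finite ℤ O := Subring.finite_of_natCast_mul_mem _ hd hdO
  have hinv : x.IsInvariant G := fun g i j => by
    have := (hdO x hx).1 g i j
    rw [← nsmul_eq_mul] at this
    simpa [hd] using this
  have key : ∀ i j, ∃ z : ℤ, (z : ℚ) = Fintype.card G * x i j := by
    intro i j
    -- `e` is the orbit sum of the elementary matrices at `(g • j, g • i)`, so that `tr (x e) = ∑ g,
    -- x (g • i) (g • j) = |G| x i j`. As `x e` lies in the order `O`, this trace is an integer.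
    let e : Matrix n n ℤ := Matrix.of fun p q => ∑ g : G, if p = g • j ∧ q = g • i then 1 else 0
    have he : e.map (Int.castRingHom ℚ) ∈ Matrix.integralInvariant G n := by
      refine ⟨fun g p q => ?_, e, rfl⟩
      simp only [Matrix.map_apply, e, Matrix.of_apply]
      rw [← Equiv.sum_comp (Equiv.mulLeft g)]
      simp [mul_smul]
    have hint : IsIntegral ℤ (x * e.map (Int.castRingHom ℚ)) := by
      have := IsIntegral.of_finite ℤ (⟨_, O.mul_mem hx (hO he)⟩ : O)
      exact this.map (O.subtype.toIntAlgHom)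
    obtain ⟨z, hz⟩ := IsIntegrallyClosed.isIntegral_iff.1 (Matrix.isIntegral_trace hint)
    refine ⟨z, hz.trans ?_⟩
    simp only [Matrix.trace, Matrix.diag_apply, Matrix.mul_apply, Matrix.map_apply, e,
      Matrix.of_apply, map_sum, Finset.mul_sum]
    rw [Finset.sum_congr rfl fun _ _ => Finset.sum_comm, Finset.sum_comm]
    have : ∀ g : G, (∑ p, ∑ q, x p q * (Int.castRingHom ℚ) (if q = g • j ∧ p = g • i then 1 else 0))
        = x i j := fun g => by
      rw [Finset.sum_eq_single (g • i), Finset.sum_eq_single (g • j)]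
      · simp [hinv g i j]
      · intro q _ hq; simp [hq]
      · simp
      · intro p _ hp; simp [hp]
      · simp
    exact (Finset.sum_congr rfl fun g _ => this g).trans (by simp)
  choose z hz using key
  rw [← nsmul_eq_mul]
  refine ⟨fun g i j => by simp [hinv g i j], Matrix.of z, ?_⟩
  ext i j
  simp [hz]

theorem Rat.exists_common_denominator {κ : Type*} [Fintype κ] (f : κ → ℚ) :
    ∃ d : ℕ, d ≠ 0 ∧ ∀ k, ∃ z : ℤ, (z : ℚ) = d * f k := by
  refine ⟨∏ k, (f k).den, Finset.prod_ne_zero_iff.2 fun k _ => (f k).den_ne_zero, fun k => ?_⟩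
  obtain ⟨c, hc⟩ := Finset.dvd_prod_of_mem (fun k => (f k).den) (Finset.mem_univ k)
  refine ⟨c * (f k).num, ?_⟩
  rw [hc]
  push_cast
  rw [mul_comm ((f k).den : ℚ), mul_assoc, Rat.den_mul_eq_num]

/-- If a nonzero multiple of the identity of `ℚ[m]` factors through powers of `ℚ[n]`, then
`|G| ^ 2` times the identity of `ℤ[m]` factors through powers of `ℤ[n]`. -/
theorem Matrix.exists_integral_sum_mul_eq_card_sq {G m n ι : Type*} [Group G] [Fintype G]
    [MulAction G m] [MulAction G n] [Fintype m] [Fintype n] [DecidableEq m] [DecidableEq n]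
    [Fintype ι] (x : ι → Matrix m n ℚ) (y : ι → Matrix n m ℚ) (hx : ∀ i, (x i).IsInvariant G)
    (hy : ∀ i, (y i).IsInvariant G) {c : ℕ} (hc : c ≠ 0) (h : ∑ i, x i * y i = (c : Matrix m m ℚ)) :
    ∃ (κ : Type) (_ : Fintype κ) (u : κ → Matrix m n ℤ) (v : κ → Matrix n m ℤ),
      (∀ k, (u k).IsInvariant G) ∧ (∀ k, (v k).IsInvariant G) ∧
        ∑ k, u k * v k = ((Fintype.card G ^ 2 : ℕ) : Matrix m m ℤ) := by
  let Λ := Matrix.integralInvariant G (m ⊕ n)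
  let ε : Matrix (m ⊕ n) (m ⊕ n) ℚ := Matrix.fromBlocks 0 0 0 1
  have hε2 : ε * ε = ε := by simp [ε, Matrix.fromBlocks_multiply]
  have hε : ε ∈ Λ := by
    refine ⟨?_, Matrix.fromBlocks 0 0 0 1, ?_⟩
    · rintro g (i | i) (j | j) <;> simp [ε, Matrix.one_apply]
    · simp [ε, Matrix.fromBlocks_map]
  obtain ⟨d, hd, hd'⟩ := Rat.exists_common_denominator
    (Sum.elim (fun k : ι × m × n => x k.1 k.2.1 k.2.2) fun k : ι × n × m => y k.1 k.2.1 k.2.2)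
  have hu : ∀ i, Matrix.fromBlocks 0 ((d : ℚ) • x i) 0 0 ∈ Λ := fun i => by
    choose z hz using fun p q => hd' (Sum.inl (i, p, q))
    refine ⟨?_, Matrix.fromBlocks 0 (Matrix.of z) 0 0, ?_⟩
    · rintro g (p | p) (q | q) <;> simp [hx i g]
    · ext (p | p) (q | q) <;> simp [hz]
  have hv : ∀ i, Matrix.fromBlocks 0 0 ((d : ℚ) • y i) 0 ∈ Λ := fun i => by
    choose z hz using fun p q => hd' (Sum.inr (i, p, q))
    refine ⟨?_, Matrix.fromBlocks 0 0 (Matrix.of z) 0, ?_⟩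
    · rintro g (p | p) (q | q) <;> simp [hy i g]
    · ext (p | p) (q | q) <;> simp [hz]
  have ha : ((d ^ 2 * c : ℕ) : Matrix (m ⊕ n) (m ⊕ n) ℚ) ∈
      AddSubgroup.closure {z | ∃ x ∈ Λ, ∃ y ∈ Λ, z = x * ε * y} := by
    -- The sum accounts for the `m`-block of the scalar matrix; the last term is its `n`-block,
    -- which lies in the ideal because that block is `ε` itself.
    have : ((d ^ 2 * c : ℕ) : Matrix (m ⊕ n) (m ⊕ n) ℚ) =
        ∑ i, Matrix.fromBlocks 0 ((d : ℚ) • x i) 0 0 * ε * Matrix.fromBlocks 0 0 ((d : ℚ) • y i) 0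
        + ((d ^ 2 * c : ℕ) : Matrix (m ⊕ n) (m ⊕ n) ℚ) * ε * 1 := by
      have h1 : ∀ i, Matrix.fromBlocks 0 ((d : ℚ) • x i) 0 0 * ε *
          Matrix.fromBlocks 0 0 ((d : ℚ) • y i) 0 =
          Matrix.fromBlocks ((d ^ 2 : ℚ) • (x i * y i)) 0 0 (0 : Matrix n n ℚ) := fun i => by
        simp [ε, Matrix.fromBlocks_multiply, smul_smul, sq]
      have h2 : ∑ i, Matrix.fromBlocks ((d ^ 2 : ℚ) • (x i * y i)) 0 0 (0 : Matrix n n ℚ) =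
          Matrix.fromBlocks ((d ^ 2 : ℚ) • (c : Matrix m m ℚ)) 0 0 0 := by
        rw [← h, Finset.smul_sum]
        ext (p | p) (q | q) <;> simp [Matrix.sum_apply]
      have h3 : ((d ^ 2 * c : ℕ) : Matrix (m ⊕ n) (m ⊕ n) ℚ) = Matrix.fromBlocks
          ((d ^ 2 : ℚ) • (c : Matrix m m ℚ)) 0 0 ((d ^ 2 : ℚ) • (c : Matrix n n ℚ)) := by
        ext (p | p) (q | q) <;>
          simp [Matrix.natCast_apply]
      rw [Finset.sum_congr rfl fun i _ => h1 i, h2, h3]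
      simp [ε, Matrix.fromBlocks_multiply, Matrix.fromBlocks_add]
    rw [this]
    exact AddSubgroup.add_mem _
      (AddSubgroup.sum_mem _ fun i _ => AddSubgroup.subset_closure ⟨_, hu i, _, hv i, rfl⟩)
      (AddSubgroup.subset_closure ⟨_, natCast_mem Λ _, _, Λ.one_mem, rfl⟩)
  have hmem := Λ.sq_mem_closure_of_isIdempotentElem (Fintype.card_ne_zero (α := G))
    (fun O hO d hd hdO x hx => Matrix.card_mul_mem_integralInvariant hO hd hdO hx) hε hε2
    (mul_ne_zero (pow_ne_zero 2 hd) hc) ha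
  have key : ∀ z ∈ AddSubgroup.closure {z | ∃ x ∈ Λ, ∃ y ∈ Λ, z = x * ε * y},
      ∃ (κ : Type) (_ : Fintype κ) (u : κ → Matrix m n ℤ) (v : κ → Matrix n m ℤ),
      (∀ k, (u k).IsInvariant G) ∧ (∀ k, (v k).IsInvariant G) ∧
        z.toBlocks₁₁ = (∑ k, u k * v k).map (Int.castRingHom ℚ) := fun z hz => by
    induction hz using AddSubgroup.closure_induction with
    | mem z hz =>
      obtain ⟨_, ⟨hx, x, rfl⟩, _, ⟨hy, y, rfl⟩, rfl⟩ := hz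
      refine ⟨Unit, inferInstance, fun _ => x.toBlocks₁₂, fun _ => y.toBlocks₂₁,
        fun _ g i j => ?_, fun _ g i j => ?_, ?_⟩
      · simpa [Matrix.toBlocks₁₂] using hx g (Sum.inl i) (Sum.inr j)
      · simpa [Matrix.toBlocks₂₁] using hy g (Sum.inr i) (Sum.inl j)
      · rw [← Matrix.fromBlocks_toBlocks x, ← Matrix.fromBlocks_toBlocks y]
        ext i j
        simp [ε, Matrix.fromBlocks_map, Matrix.fromBlocks_multiply, Matrix.mul_apply]
    | zero => exact ⟨Empty, inferInstance, Empty.elim, Empty.elim, nofun, nofun, by ext; simp [Matrix.toBlocks₁₁]⟩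
    | add z w _ _ hz hw =>
      obtain ⟨κ, _, u, v, hu, hv, h⟩ := hz
      obtain ⟨κ', _, u', v', hu', hv', h'⟩ := hw
      refine ⟨κ ⊕ κ', inferInstance, Sum.elim u u', Sum.elim v v', ?_, ?_, ?_⟩
      · rintro (k | k); exacts [hu k, hu' k]
      · rintro (k | k); exacts [hv k, hv' k]
      · have : (z + w).toBlocks₁₁ = z.toBlocks₁₁ + w.toBlocks₁₁ := rfl
        rw [this, h, h']
        ext; simp
    | neg z _ hz =>
      obtain ⟨κ, _, u, v, hu, hv, h⟩ := hz
      refine ⟨κ, inferInstance, -u, v, fun k g i j => ?_, hv, ?_⟩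
      · simp [hu k g i j]
      · have : (-z).toBlocks₁₁ = -z.toBlocks₁₁ := rfl
        rw [this, h]
        ext; simp
  obtain ⟨κ, hκ, u, v, hu, hv, h⟩ := key _ hmem
  refine ⟨κ, hκ, u, v, hu, hv, ?_⟩
  ext i j
  have := congrFun (congrFun h i) j
  rw [← Nat.cast_mul, ← sq] at this
  rw [← Int.cast_inj (α := ℚ)]
  refine Eq.trans this.symm ?_
  by_cases hij : i = j <;> simp [Matrix.toBlocks₁₁, Matrix.natCast_apply, hij]

/-! ### Norm relations as matrix identities -/

/-- The right regular representation of `ℚ[G]` by `G`-invariant matrices. -/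
noncomputable def MonoidAlgebra.rightRegularMatrix (G : Type*) [Group G] [Fintype G] [DecidableEq G] :
    MonoidAlgebra ℚ G →ₐ[ℚ] Matrix G G ℚ :=
  MonoidAlgebra.lift ℚ _ G
    { toFun := fun g => Matrix.of fun x y => if x * g = y then 1 else 0
      map_one' := by ext; simp [Matrix.one_apply]
      map_mul' := fun g h => by
        ext x y
        simp only [Matrix.mul_apply, Matrix.of_apply, ite_mul, one_mul, zero_mul,
          Finset.sum_ite_eq, Finset.mem_univ, if_true, mul_assoc] }

theorem MonoidAlgebra.rightRegularMatrix_of {G : Type*} [Group G] [Fintype G] [DecidableEq G]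
    (g x y : G) :
    rightRegularMatrix G (of ℚ G g) x y = if x * g = y then 1 else 0 := by
  simp [rightRegularMatrix]

theorem MonoidAlgebra.isInvariant_rightRegularMatrix {G : Type*} [Group G] [Fintype G]
    [DecidableEq G] (a : MonoidAlgebra ℚ G) : (rightRegularMatrix G a).IsInvariant G :=
    fun g x y => by
  induction a using MonoidAlgebra.induction_on with
  | of h =>
    rw [rightRegularMatrix_of, rightRegularMatrix_of]
    simp [mul_assoc]
  | add a b ha hb => rw [map_add, Matrix.add_apply, Matrix.add_apply, ha, hb]
  | smul r a ha =>
    rw [map_smul, Matrix.smul_apply, Matrix.smul_apply, ha]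

open Classical in
/-- The incidence matrix of the projection `G → G ⧸ J`. -/
noncomputable def Subgroup.incidenceMatrix {G : Type*} [Group G] (J : Subgroup G) :
    Matrix G (G ⧸ J) ℚ :=
  Matrix.of fun x q => if (x : G ⧸ J) = q then 1 else 0

theorem Subgroup.isInvariant_incidenceMatrix {G : Type*} [Group G] (J : Subgroup G) :
    J.incidenceMatrix.IsInvariant G := fun g x q => by
  simp only [incidenceMatrix, Matrix.of_apply]
  congr 1
  exact propext ((MulAction.injective (β := G ⧸ J) g).eq_iff (a := (x : G ⧸ J)))

/-- Both sides have entry `1` at `(x, y)` exactly when `xJ = yJ`. This makes the norm element factor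
through `ℚ[G/J]`. -/
theorem Subgroup.rightRegularMatrix_normElement {G : Type*} [Group G] [Fintype G]
    [DecidableEq G] (J : Subgroup G) [Fintype (G ⧸ J)] :
    MonoidAlgebra.rightRegularMatrix G (normElement ℚ J) =
      J.incidenceMatrix * J.incidenceMatrix.transpose := by
  classical
  ext x y
  rw [normElement, finsum_eq_sum_of_fintype, map_sum, Matrix.sum_apply]
  simp only [MonoidAlgebra.rightRegularMatrix_of, Matrix.mul_apply, incidenceMatrix,
    Matrix.of_apply, Matrix.transpose_apply, mul_ite, mul_one, mul_zero, Finset.sum_ite_eq,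
    Finset.mem_univ, if_true]
  by_cases h : x⁻¹ * y ∈ J
  · rw [if_pos (QuotientGroup.eq.2 h), Finset.sum_eq_single ⟨_, h⟩]
    · simp
    · intro b _ hb
      exact if_neg fun h' => hb (Subtype.ext (by simp [← h']))
    · simp
  · rw [if_neg fun h' => h (QuotientGroup.eq.1 h')]
    exact Finset.sum_eq_zero fun b _ => if_neg fun h' => h (by simp [← h'])

theorem Subgroup.transpose_incidenceMatrix_mul {G : Type*} [Group G] [Fintype G]
    (H : Subgroup G) [DecidableEq (G ⧸ H)] :
    H.incidenceMatrix.transpose * H.incidenceMatrix =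
      (Nat.card H : Matrix (G ⧸ H) (G ⧸ H) ℚ) := by
  ext q r
  simp only [Matrix.mul_apply, incidenceMatrix, Matrix.of_apply, Matrix.transpose_apply,
    Matrix.natCast_apply]
  by_cases h : q = r
  · subst h
    have := QuotientGroup.card_preimage_mk H {q}
    rw [Nat.card_coe_set_eq, Nat.card_coe_set_eq, Set.ncard_singleton, mul_one] at this
    classical
    rw [if_pos rfl, ← this, Set.ncard_eq_toFinset_card']
    simp only [mul_ite, mul_one, mul_zero, ← ite_and, and_self, Finset.sum_boole]
    congr 2
    ext x
    simp
  · rw [if_neg h]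
    exact Finset.sum_eq_zero fun x _ => by
      by_cases hx : (x : G ⧸ H) = q
      · simp [hx, h]
      · simp [hx]

/-- A generalised norm relation gives an integral factorization of `|G| ^ 2` through the
permutation modules `ℤ[G/J]`, in matrix form. -/
theorem HasGeneralisedNormRelation.exists_integral_matrix {G : Type*} [Group G] [Fintype G]
    {𝒥 : Set (Subgroup G)} {H : Subgroup G} (h : HasGeneralisedNormRelation ℚ 𝒥 H)
    [∀ J : Subgroup G, Fintype (G ⧸ J)] [∀ J : Subgroup G, DecidableEq (G ⧸ J)] :
    ∃ (κ : Type) (_ : Fintype κ) (J : κ → Subgroup G) (u : ∀ k, Matrix (G ⧸ H) (G ⧸ J k) ℤ)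
      (v : ∀ k, Matrix (G ⧸ J k) (G ⧸ H) ℤ), (∀ k, J k ∈ 𝒥) ∧ (∀ k, (u k).IsInvariant G) ∧
        (∀ k, (v k).IsInvariant G) ∧
        ∑ k, u k * v k = ((Fintype.card G ^ 2 : ℕ) : Matrix (G ⧸ H) (G ⧸ H) ℤ) := by
  classical
  obtain ⟨l, J, a, b, hJ, hrel⟩ := h
  let K := MonoidAlgebra.rightRegularMatrix G
  let x : ∀ k, Matrix (G ⧸ H) (G ⧸ J k) ℚ := fun k =>
    H.incidenceMatrix.transpose * K (a k) * (J k).incidenceMatrix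
  let y : ∀ k, Matrix (G ⧸ J k) (G ⧸ H) ℚ := fun k =>
    (J k).incidenceMatrix.transpose * K (b k) * H.incidenceMatrix
  have hx : ∀ k, (x k).IsInvariant G := fun k =>
    (H.isInvariant_incidenceMatrix.transpose.mul
      (MonoidAlgebra.isInvariant_rightRegularMatrix _)).mul (J k).isInvariant_incidenceMatrix
  have hy : ∀ k, (y k).IsInvariant G := fun k =>
    ((J k).isInvariant_incidenceMatrix.transpose.mul
      (MonoidAlgebra.isInvariant_rightRegularMatrix _)).mul H.isInvariant_incidenceMatrix
  -- With `P` the incidence matrix of `H`, the relation becomes `Pᵀ(P Pᵀ)P = (PᵀP)² = |H|²`.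
  have hxy : ∑ k, x k * y k = ((Nat.card H * Nat.card H : ℕ) : Matrix (G ⧸ H) (G ⧸ H) ℚ) := by
    have h1 : ∀ k, x k * y k = H.incidenceMatrix.transpose *
        K (a k * normElement ℚ (J k) * b k) * H.incidenceMatrix := fun k => by
      rw [map_mul, map_mul, (J k).rightRegularMatrix_normElement]
      simp only [x, y, Matrix.mul_assoc]
    rw [Finset.sum_congr rfl fun k _ => h1 k, ← Matrix.sum_mul, ← Matrix.mul_sum, ← map_sum,
      ← hrel, H.rightRegularMatrix_normElement, Nat.cast_mul, ← H.transpose_incidenceMatrix_mul]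
    simp only [Matrix.mul_assoc]
  -- The sum over `k` is absorbed into the single `G`-set `⨆ₖ G/Jₖ`, then recovered by cutting the
  -- matrices into blocks.
  obtain ⟨κ, hκ, u, v, hu, hv, huv⟩ := Matrix.exists_integral_sum_mul_eq_card_sq (G := G)
    (ι := Unit) (n := Σ k, G ⧸ J k) (fun _ => Matrix.of fun q r => x r.1 q r.2)
    (fun _ => Matrix.of fun r q => y r.1 r.2 q) (fun _ g q r => hx r.1 g q r.2)
    (fun _ g r q => hy r.1 g r.2 q) (c := Nat.card H * Nat.card H) (by simp)
    (by
      rw [← hxy]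
      ext q r
      simp [Matrix.mul_apply, Fintype.sum_sigma, Matrix.sum_apply])
  refine ⟨κ × Fin l, inferInstance, fun k => J k.2,
    fun k => Matrix.of fun q r => u k.1 q ⟨k.2, r⟩, fun k => Matrix.of fun r q => v k.1 ⟨k.2, r⟩ q,
    fun k => (hJ _).1, fun k g q r => hu k.1 g q ⟨k.2, r⟩, fun k g r q => hv k.1 g ⟨k.2, r⟩ q, ?_⟩
  rw [← huv]
  ext q r
  simp [Matrix.mul_apply, Fintype.sum_sigma, Matrix.sum_apply, Fintype.sum_prod_type]

/-! ### From invariant matrices to maps of permutation modules -/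

/-- The linear map `R[m] → R[n]` given by the rows of a matrix. -/
noncomputable def Matrix.rowHom {m n R : Type*} [CommRing R] [Fintype n] (w : Matrix m n R) :
    MonoidAlgebra R m →ₗ[R] MonoidAlgebra R n :=
  Finsupp.linearCombination R (fun q => ∑ r, MonoidAlgebra.single r (w q r)) ∘ₗ
    (MonoidAlgebra.coeffLinearEquiv R).toLinearMap

theorem Matrix.rowHom_single {m n R : Type*} [CommRing R] [Fintype n] (w : Matrix m n R)
    (q : m) (z : R) :
    w.rowHom (MonoidAlgebra.single q z) = ∑ r, MonoidAlgebra.single r (z * w q r) := by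
  simp [rowHom, Finset.smul_sum]

theorem MonoidAlgebra.single_finset_sum {ι m R : Type*} [CommRing R] (q : m) (s : Finset ι)
    (f : ι → R) : single q (∑ i ∈ s, f i) = ∑ i ∈ s, single q (f i) :=
  map_sum (MonoidAlgebra.lsingle (R := R) q) f s

theorem Matrix.rowHom_mul {l m n R : Type*} [CommRing R] [Fintype m] [Fintype n]
    (u : Matrix l m R) (v : Matrix m n R) : (u * v).rowHom = v.rowHom ∘ₗ u.rowHom := by
  refine MonoidAlgebra.lhom_ext' fun q => LinearMap.ext fun z => ?_
  simp only [LinearMap.comp_apply, MonoidAlgebra.lsingle_apply, rowHom_single, map_sum,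
    Matrix.mul_apply, Finset.mul_sum, MonoidAlgebra.single_finset_sum, mul_assoc]
  exact Finset.sum_comm

theorem Matrix.rowHom_sum {ι m n R : Type*} [CommRing R] [Fintype n] (s : Finset ι)
    (w : ι → Matrix m n R) : (∑ i ∈ s, w i).rowHom = ∑ i ∈ s, (w i).rowHom := by
  refine MonoidAlgebra.lhom_ext' fun q => LinearMap.ext fun z => ?_
  simp only [LinearMap.comp_apply, MonoidAlgebra.lsingle_apply, LinearMap.sum_apply,
    rowHom_single, Matrix.sum_apply, Finset.mul_sum, MonoidAlgebra.single_finset_sum]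
  exact Finset.sum_comm

theorem Matrix.rowHom_natCast {n R : Type*} [CommRing R] [Fintype n] [DecidableEq n] (c : ℕ) :
    (c : Matrix n n R).rowHom = c • LinearMap.id := by
  refine MonoidAlgebra.lhom_ext' fun q => LinearMap.ext fun z => ?_
  simp only [LinearMap.comp_apply, MonoidAlgebra.lsingle_apply, LinearMap.smul_apply,
    rowHom_single, Matrix.natCast_apply, LinearMap.id_apply]
  rw [Finset.sum_eq_single q]
  · rw [if_pos rfl, mul_comm, ← nsmul_eq_mul, MonoidAlgebra.smul_single]
  · intro r _ hr; simp [hr.symm]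
  · simp

theorem Matrix.IsInvariant.rowHom_comm {G m n R : Type*} [Group G] [MulAction G m]
    [MulAction G n] [CommRing R] [Fintype n] {w : Matrix m n R} (hw : w.IsInvariant G) (g : G)
    (v : MonoidAlgebra R m) :
    w.rowHom (Representation.ofMulAction R G m g v) =
      Representation.ofMulAction R G n g (w.rowHom v) := by
  refine LinearMap.congr_fun (f := w.rowHom ∘ₗ Representation.ofMulAction R G m g)
    (g := Representation.ofMulAction R G n g ∘ₗ w.rowHom) ?_ v
  refine MonoidAlgebra.lhom_ext' fun q => LinearMap.ext fun z => ?_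
  simp only [LinearMap.comp_apply, MonoidAlgebra.lsingle_apply, rowHom_single, map_sum,
    Representation.ofMulAction_single]
  rw [← Equiv.sum_comp (MulAction.toPerm g)]
  simp [hw g]

/-- The homomorphism of permutation modules given by an invariant integral matrix. -/
noncomputable def Matrix.toPermModuleHom {G : Type*} [Group G] {H J : Subgroup G}
    [Fintype (G ⧸ J)] (w : Matrix (G ⧸ H) (G ⧸ J) ℤ) (hw : w.IsInvariant G) :
    PermModule H →ₗ[MonoidAlgebra ℤ G] PermModule J :=
  MonoidAlgebra.equivariantOfLinearOfComm
    ((Representation.ofMulAction ℤ G (G ⧸ J)).asModuleEquiv.symm.toLinearMap ∘ₗ w.rowHom ∘ₗ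
      (Representation.ofMulAction ℤ G (G ⧸ H)).asModuleEquiv.toLinearMap)
    (fun g v => by
      rw [Representation.single_smul, Representation.single_smul, one_smul, one_smul]
      exact hw.rowHom_comm g ((Representation.ofMulAction ℤ G (G ⧸ H)).asModuleEquiv v))

/-! ### Factoring endomorphisms and divisibility of norm coefficients -/

/-- The endomorphisms of `X` that are sums of endomorphisms factoring through some `Y i`. -/
def LinearMap.factorThrough (R X : Type*) {ι : Type*} (Y : ι → Type*) [Ring R] [AddCommGroup X]
    [Module R X] [∀ i, AddCommGroup (Y i)] [∀ i, Module R (Y i)] : AddSubgroup (X →ₗ[R] X) :=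
  AddSubgroup.closure {f | ∃ (i : ι) (α : X →ₗ[R] Y i) (β : Y i →ₗ[R] X), β ∘ₗ α = f}

theorem LinearMap.comp_mem_factorThrough {R X : Type*} {ι : Type*} {Y : ι → Type*} [Ring R]
    [AddCommGroup X] [Module R X] [∀ i, AddCommGroup (Y i)] [∀ i, Module R (Y i)] {i : ι}
    (α : X →ₗ[R] Y i) (β : Y i →ₗ[R] X) : β ∘ₗ α ∈ LinearMap.factorThrough R X Y :=
  AddSubgroup.subset_closure ⟨i, α, β, rfl⟩

theorem LinearMap.mod_nsmul_mem_factorThrough {R X : Type*} {ι : Type*} {Y : ι → Type*} [Ring R]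
    [AddCommGroup X] [Module R X] [∀ i, AddCommGroup (Y i)] [∀ i, Module R (Y i)]
    {f : X →ₗ[R] X} {c d : ℕ} (hc : c • f ∈ LinearMap.factorThrough R X Y)
    (hd : d • f ∈ LinearMap.factorThrough R X Y) :
    (d % c) • f ∈ LinearMap.factorThrough R X Y := by
  have h := AddSubgroup.sub_mem _ hd (AddSubgroup.nsmul_mem _ hc (d / c))
  rwa [← mul_nsmul, sub_eq_iff_eq_add.2 (by rw [← add_nsmul, Nat.mod_add_div])] at h

theorem LinearMap.mem_factorThrough_iff {R X : Type*} {ι : Type*} {Y : ι → Type*} [Ring R]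
    [AddCommGroup X] [Module R X] [∀ i, AddCommGroup (Y i)] [∀ i, Module R (Y i)] [Finite ι]
    {f : X →ₗ[R] X} :
    f ∈ LinearMap.factorThrough R X Y ↔ ∃ (n : ι → ℕ)
      (ψ : X →ₗ[R] DirectSum ι fun i => Fin (n i) → Y i)
      (φ : (DirectSum ι fun i => Fin (n i) → Y i) →ₗ[R] X), φ ∘ₗ ψ = f := by
  classical
  have := Fintype.ofFinite ι
  constructor
  · intro hf
    -- One index type `κ` serves every `i`, with zero maps as padding, so all multiplicities `n i`
    -- can be taken equal to the size of `κ`.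
    obtain ⟨κ, _, α, β, rfl⟩ : ∃ (κ : Type) (_ : Fintype κ) (α : ∀ i, κ → (X →ₗ[R] Y i))
        (β : ∀ i, κ → (Y i →ₗ[R] X)), f = ∑ i, ∑ k, β i k ∘ₗ α i k := by
      induction hf using AddSubgroup.closure_induction with
      | mem f hf =>
        obtain ⟨i, α, β, rfl⟩ := hf
        refine ⟨Unit, inferInstance, fun j _ => Pi.single (M := fun j => X →ₗ[R] Y j) i α j,
          fun j _ => Pi.single (M := fun j => Y j →ₗ[R] X) i β j, ?_⟩
        rw [Finset.sum_eq_single i]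
        · simp
        · intro j _ hj; simp [hj]
        · simp
      | zero => exact ⟨Empty, inferInstance, nofun, nofun, by simp⟩
      | add f g _ _ hf hg =>
        obtain ⟨κ, _, α, β, rfl⟩ := hf
        obtain ⟨κ', _, α', β', rfl⟩ := hg
        exact ⟨κ ⊕ κ', inferInstance, fun i => Sum.elim (α i) (α' i),
          fun i => Sum.elim (β i) (β' i), by simp [Finset.sum_add_distrib]⟩
      | neg f _ hf =>
        obtain ⟨κ, _, α, β, rfl⟩ := hf
        exact ⟨κ, inferInstance, -α, β, by simp [LinearMap.comp_neg]⟩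
    let e := Fintype.equivFin κ
    refine ⟨fun _ => Fintype.card κ,
      ∑ i, DirectSum.lof R ι (fun i => Fin (Fintype.card κ) → Y i) i ∘ₗ
        LinearMap.pi fun t => α i (e.symm t),
      DirectSum.toModule R ι X fun i => ∑ t, β i (e.symm t) ∘ₗ LinearMap.proj t, ?_⟩
    ext x
    simp only [LinearMap.comp_apply, LinearMap.sum_apply, map_sum, DirectSum.toModule_lof,
      LinearMap.proj_apply, LinearMap.pi_apply]
    exact Finset.sum_congr rfl fun i _ => Equiv.sum_comp e.symm fun k => β i k (α i k x)
  · rintro ⟨n, ψ, φ, rfl⟩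
    have : φ ∘ₗ ψ = ∑ i, ∑ t : Fin (n i),
        (φ ∘ₗ DirectSum.lof R ι (fun i => Fin (n i) → Y i) i ∘ₗ LinearMap.single R _ t) ∘ₗ
          (LinearMap.proj t ∘ₗ DirectSum.component R ι (fun i => Fin (n i) → Y i) i ∘ₗ ψ) := by
      ext x
      simp only [LinearMap.comp_apply, LinearMap.sum_apply, ← map_sum, LinearMap.coe_proj,
        Function.eval, LinearMap.coe_single, Finset.univ_sum_single, DirectSum.lof_eq_of]
      congr 1
      exact (DirectSum.sum_univ_of (ψ x)).symm
    rw [this]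
    exact AddSubgroup.sum_mem _ fun i _ => AddSubgroup.sum_mem _ fun t _ =>
      LinearMap.comp_mem_factorThrough _ _

/-- The quotient is finitely generated and killed by `c`, hence finite. -/
theorem AddSubgroup.finiteIndex_of_forall_nsmul_mem {X : Type*} [AddCommGroup X]
    [AddGroup.FG X] (S : AddSubgroup X) {c : ℕ} (hc : c ≠ 0) (h : ∀ x : X, c • x ∈ S) :
    S.FiniteIndex := by
  have : Module.Finite ℤ X := Module.Finite.iff_addGroup_fg.2 inferInstance
  have : Module.Finite ℤ (X ⧸ S) := Module.Finite.of_surjective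
    (QuotientAddGroup.mk' S).toIntLinearMap (QuotientAddGroup.mk'_surjective S)
  have : Finite (X ⧸ S) := Module.finite_of_fg_torsion _ fun x => by
    obtain ⟨x, rfl⟩ := QuotientAddGroup.mk'_surjective S x
    refine ⟨⟨(c : ℤ), mem_nonZeroDivisors_of_ne_zero (Nat.cast_ne_zero.2 hc)⟩, ?_⟩
    change (c : ℤ) • QuotientAddGroup.mk' S x = 0
    rw [natCast_zsmul, ← map_nsmul]
    exact (QuotientAddGroup.eq_zero_iff _).2 (h x)
  exact AddSubgroup.finiteIndex_of_finite_quotient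

instance PermModule.addGroup_fg {G : Type*} [Group G] [Finite G] (H : Subgroup G) :
    AddGroup.FG (PermModule H) := by
  have : Module.Finite ℤ (MonoidAlgebra ℤ (G ⧸ H)) :=
    Module.Finite.equiv (MonoidAlgebra.coeffLinearEquiv ℤ).symm
  exact Module.Finite.iff_addGroup_fg.1 this

theorem PermModule.nsmul_right_injective {G : Type*} [Group G] (H : Subgroup G) {c : ℕ}
    (hc : c ≠ 0) : Function.Injective fun x : PermModule H => c • x := by
  intro x y h
  change MonoidAlgebra ℤ (G ⧸ H) at x y
  exact smul_right_injective (MonoidAlgebra ℤ (G ⧸ H)) hc h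

/-- `c` is a norm coefficient if and only if it is positive and `c · id` is a sum of maps
factoring through the `ℤ[G/J]`. -/
theorem isNormCoefficient_iff {G : Type*} [Group G] [Finite G] {𝒥 : Set (Subgroup G)}
    {H : Subgroup G} {c : ℕ} :
    IsNormCoefficient 𝒥 H c ↔ 0 < c ∧ (c • LinearMap.id : PermModule H →ₗ[MonoidAlgebra ℤ G] _) ∈
      LinearMap.factorThrough (MonoidAlgebra ℤ G) (PermModule H)
        fun J : 𝒥 => PermModule (J : Subgroup G) := by
  rw [LinearMap.mem_factorThrough_iff]
  refine and_congr_right fun hc => ⟨fun ⟨n, ψ, φ, _, _, h⟩ => ⟨n, ψ, φ, h⟩,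
    fun ⟨n, ψ, φ, h⟩ => ⟨n, ψ, φ, ?_, ?_, h⟩⟩
  · refine Function.Injective.of_comp (f := φ) ?_
    rw [← LinearMap.coe_comp, h]
    exact PermModule.nsmul_right_injective H hc.ne'
  · exact AddSubgroup.finiteIndex_of_forall_nsmul_mem _ hc.ne' fun x =>
      ⟨ψ x, LinearMap.congr_fun h x⟩

theorem HasGeneralisedNormRelation.isNormCoefficient {G : Type*} [Group G] [Finite G]
    {𝒥 : Set (Subgroup G)} {H : Subgroup G} (h : HasGeneralisedNormRelation ℚ 𝒥 H) :
    IsNormCoefficient 𝒥 H (Nat.card G ^ 2) := by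
  classical
  have := Fintype.ofFinite G
  have (J : Subgroup G) : Fintype (G ⧸ J) := Fintype.ofFinite _
  obtain ⟨κ, _, J, u, v, hJ, hu, hv, huv⟩ := h.exists_integral_matrix
  refine isNormCoefficient_iff.2 ⟨pow_pos Nat.card_pos 2, ?_⟩
  have hsum (x : MonoidAlgebra ℤ (G ⧸ H)) :
      Nat.card G ^ 2 • x = ∑ k, (v k).rowHom ((u k).rowHom x) := by
    have := LinearMap.congr_fun (congrArg Matrix.rowHom huv) x
    rw [Matrix.rowHom_natCast, Matrix.rowHom_sum, LinearMap.sum_apply] at this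
    rw [Nat.card_eq_fintype_card]
    simpa only [Matrix.rowHom_mul, LinearMap.smul_apply, LinearMap.id_apply,
      LinearMap.comp_apply] using this.symm
  have hsum' : (Nat.card G ^ 2 • LinearMap.id : PermModule H →ₗ[MonoidAlgebra ℤ G] _) =
      ∑ k, (v k).toPermModuleHom (hv k) ∘ₗ (u k).toPermModuleHom (hu k) := by
    refine LinearMap.ext fun x => ?_
    rw [LinearMap.sum_apply]
    exact hsum x
  rw [hsum']
  exact AddSubgroup.sum_mem _ fun k _ => LinearMap.comp_mem_factorThrough
    (Y := fun J : 𝒥 => PermModule (J : Subgroup G)) (i := ⟨J k, hJ k⟩) _ _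

/-- One step of Euclidean division in the ideal of admissible integers; non-divisibility keeps the
remainder positive. -/
theorem IsNormCoefficient.mod {G : Type*} [Group G] [Finite G] {𝒥 : Set (Subgroup G)}
    {H : Subgroup G} {c d : ℕ} (hc : IsNormCoefficient 𝒥 H c) (hd : IsNormCoefficient 𝒥 H d)
    (h : ¬ c ∣ d) : IsNormCoefficient 𝒥 H (d % c) := by
  refine isNormCoefficient_iff.2 ⟨Nat.pos_of_ne_zero fun h' => h (Nat.dvd_of_mod_eq_zero h'), ?_⟩
  exact LinearMap.mod_nsmul_mem_factorThrough (isNormCoefficient_iff.1 hc).2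
    (isNormCoefficient_iff.1 hd).2

theorem mainTheorem5 {G : Type*} [Group G] [Finite G] (𝒥 : Set (Subgroup G)) (H : Subgroup G)
    (h𝒥 : ∀ J ∈ 𝒥, J ≠ ⊥) (hrel : HasGeneralisedNormRelation ℚ 𝒥 H) :
    optimalCoefficient 𝒥 H ∣ Nat.card G ^ 2 := by
  have hd := hrel.isNormCoefficient
  have hc : IsNormCoefficient 𝒥 H (optimalCoefficient 𝒥 H) :=
    Nat.sInf_mem (s := {c : ℕ | IsNormCoefficient 𝒥 H c}) ⟨_, hd⟩
  set c := optimalCoefficient 𝒥 H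
  set d := Nat.card G ^ 2
  by_contra hdvd
  have hle : c ≤ d % c := Nat.sInf_le (hc.mod hd hdvd)
  exact absurd (Nat.mod_lt d hc.1) (not_lt.2 hle)
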